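/- Setting. $K\ge 1$ arms have reward distributions $\nu_1,\dots,\nu_K$ supported in $[0,1]$, with means $\mu_1,\dots,\mu_K$; put $\mu^*=\max_i\mu_i$ and $\Delta_i=\mu^*-\mu_i$. The network is a star with node set $V$, $|V|=m\ge 1$, and centre $c$. In each round $t=1,2,\dots$ every user $v\in V$ chooses an arm $a^v(t)$ and, if $a^v(t)=i$, receives the reward $X^v_i(t)$, where the random variables $X^v_i(t)$ ($v\in V$, $1\le i\le K$, $t\ge 1$) are independent and $X^v_i(t)$ has law $\nu_i$. The users choose their arms by the Follow Your Leader (FYL) policy for the dominating set $\{c\}$: - The centre follows the policy UCB-user: for $1\le t\le K$ it plays arm $t$, and for $t\ge K$ $$a^c(t+1)\in\operatorname*{argmax}_{1\le j\le K}\ \left(\hat\mu_j(t)+\sqrt{\frac{2\ln t}{m_j(t)}}\right),$$ where $m_j(t)$ is the number of times that arm $j$ was chosen by all nodes of the star in rounds $1,\dots,t$ and $\hat\mu_j(t)$ is the average of the corresponding rewards; ties are broken by any fixed measurable rule that depends on the actions and rewards observed so far. - Each leaf $u\neq c$ chooses its first action $a^u(1)$ at random (the joint law of the first actions of the leaves is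 arbitrary, for example independent and uniform, but they are independent of the rewards), and plays $a^u(t)=a^c(t-1)$ for $t>1$. Theorem (FYL regret bound, star networks). For every $n$ and every $\beta\in(1/4,1)$, the network regret $R^G(n)=\sum_{v\in V}\sum_{t=1}^n\left(\mu^*-\mu_{a^v(t)}\right)$ is integrable and satisfies $$\mathbb E\left[R^G(n)\right]\le\sum_{i:\,\mu_i<\mu^*}\frac{8\ln n}{\Delta_i}+d,\qquad d=\left[2m-1+\frac{2m}{4\beta-1}\left(1+\frac{1}{(4\beta-1)\ln(1/\beta)}\right)\right]\sum_{j=1}^K\Delta_j .$$ -/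

import Mathlib

open MeasureTheory ProbabilityTheory

/-- The closed neighbourhood of `v` in `G`: the node `v` and its one-hop neighbours. -/
abbrev ClosedNbhd {V : Type*} (G : SimpleGraph V) (v : V) : Type _ :=
  {u : V // u = v ∨ G.Adj v u}

/-- The information available to user `v` after `t` rounds: the action and the reward of each user
in the closed neighbourhood of `v`, in each of these rounds. Rounds are indexed from `0`, so that
`h s` is what happened in round number `s + 1`. -/
abbrev History {V : Type*} (G : SimpleGraph V) (K : ℕ) (v : V) (t : ℕ) : Type _ :=
  Fin t → ClosedNbhd G v → Fin K × ℝ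

/-- A policy of user `v` prescribes, for every `t`, the action of round number `t + 1` as a function
of the information available after `t` rounds. -/
abbrev UserPolicy {V : Type*} (G : SimpleGraph V) (K : ℕ) (v : V) : Type _ :=
  (t : ℕ) → History G K v t → Fin K

/-- A table of reward samples: `x v i t` is the reward that user `v` gets in round number `t + 1`
if it chooses arm `i` in that round. -/
abbrev RewardTable (V : Type*) (K : ℕ) : Type _ := V → Fin K → ℕ → ℝ

noncomputable section

/-- The run of a network policy on a table of rewards: the action and the reward of every user in
round number `t + 1`. -/
def play {V : Type*} {G : SimpleGraph V} {K : ℕ} (Φ : (v : V) → UserPolicy G K v)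
    (x : RewardTable V K) (t : ℕ) (v : V) : Fin K × ℝ :=
  let a : Fin K := Φ v t fun s u => play Φ x s.1 u.1
  (a, x v a t)
termination_by t
decreasing_by exact s.2

/-- The action `a^v(t + 1)` of user `v` in round number `t + 1`. -/
def action {V : Type*} {G : SimpleGraph V} {K : ℕ} (Φ : (v : V) → UserPolicy G K v)
    (x : RewardTable V K) (t : ℕ) (v : V) : Fin K :=
  (play Φ x t v).1

open Classical in
/-- The number of times that arm `i` was chosen, during the history `h`, by the users in `S`. -/
def sampleCount {V : Type*} [Fintype V] {G : SimpleGraph V} {K : ℕ} {v : V} (S : Set V) {t : ℕ}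
    (h : History G K v t) (i : Fin K) : ℕ :=
  ∑ s : Fin t, ∑ u : ClosedNbhd G v, if u.1 ∈ S ∧ (h s u).1 = i then 1 else 0

open Classical in
/-- The average of the rewards of arm `i` obtained, during the history `h`, by the users in `S`. -/
def sampleMean {V : Type*} [Fintype V] {G : SimpleGraph V} {K : ℕ} {v : V} (S : Set V) {t : ℕ}
    (h : History G K v t) (i : Fin K) : ℝ :=
  (∑ s : Fin t, ∑ u : ClosedNbhd G v, if u.1 ∈ S ∧ (h s u).1 = i then (h s u).2 else 0) /
    (sampleCount S h i : ℝ)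

/-- The upper confidence index of arm `i` after `t` rounds, computed from the samples of `S`. -/
def ucbIndex {V : Type*} [Fintype V] {G : SimpleGraph V} {K : ℕ} {v : V} (S : Set V) {t : ℕ}
    (h : History G K v t) (i : Fin K) : ℝ :=
  sampleMean S h i + Real.sqrt (2 * Real.log t / (sampleCount S h i : ℝ))

/-- `φ` is a UCB-user policy of `v` based on the samples of the users in `S` (within the closed
neighbourhood of `v`): it plays each arm once in the first `K` rounds and then an arm of maximal
index. Ties may be broken by any measurable rule that uses the available information. -/
structure IsUCBUser {V : Type*} [Fintype V] {G : SimpleGraph V} {K : ℕ} {v : V} (S : Set V)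
    (φ : UserPolicy G K v) : Prop where
  initialization : ∀ (t : ℕ) (ht : t < K) (h : History G K v t), φ t h = ⟨t, ht⟩
  loop : ∀ t : ℕ, K ≤ t → ∀ (h : History G K v t) (j : Fin K),
    ucbIndex S h j ≤ ucbIndex S h (φ t h)
  measurable : ∀ t : ℕ, Measurable (φ t)

/-- A dominating set partition of `G` based on `D`: every node is assigned to a node in `D` (its
leader), which is itself for a node in `D` and a neighbour for any other node. The components are
the fibres of this map. Existence of such a map says that `D` is dominating. -/
structure DominatingPartition {V : Type*} (G : SimpleGraph V) (D : Set V) where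
  leader : V → V
  leader_mem : ∀ v, leader v ∈ D
  leader_of_mem : ∀ v ∈ D, leader v = v
  adj_leader : ∀ v, v ∉ D → G.Adj v (leader v)

/-- The component of the node `d`. -/
def DominatingPartition.component {V : Type*} {G : SimpleGraph V} {D : Set V}
    (P : DominatingPartition G D) (d : V) : Set V :=
  {u | P.leader u = d}

/-- The policy of a follower `v`: the action `a` in the first round, and from then on the action
that its leader took in the previous round. -/
def followerPolicy {V : Type*} {G : SimpleGraph V} {D : Set V} (P : DominatingPartition G D)
    {K : ℕ} {v : V} (hv : v ∉ D) (a : Fin K) : UserPolicy G K v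
  | 0, _ => a
  | t + 1, h => (h (Fin.last t) ⟨P.leader v, Or.inr (P.adj_leader v hv)⟩).1

open Classical in
/-- The Follow Your Leader policy of the network: a leader `v ∈ D` uses the policy `ψ v`, and the
followers follow their leaders, the follower `v` starting with the action `a v`. -/
def fylPolicy {V : Type*} {G : SimpleGraph V} {D : Set V} (P : DominatingPartition G D) {K : ℕ}
    (ψ : (v : V) → UserPolicy G K v) (a : V → Fin K) (v : V) : UserPolicy G K v :=
  if hv : v ∈ D then ψ v else followerPolicy P hv (a v)

/-- The mean reward of arm `i`, where `ν i` is the reward distribution of arm `i`. -/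
def armMean {K : ℕ} (ν : Fin K → Measure ℝ) (i : Fin K) : ℝ := ∫ y, y ∂(ν i)

/-- The largest mean reward. -/
def bestMean {K : ℕ} (ν : Fin K → Measure ℝ) : ℝ := ⨆ i, armMean ν i

/-- The gap of arm `i`. -/
def gap {K : ℕ} (ν : Fin K → Measure ℝ) (i : Fin K) : ℝ := bestMean ν - armMean ν i

/-- The regret of the whole network up to round number `n`. -/
def networkRegret {V : Type*} [Fintype V] {G : SimpleGraph V} {K : ℕ} (ν : Fin K → Measure ℝ)
    (Φ : (v : V) → UserPolicy G K v) (x : RewardTable V K) (n : ℕ) : ℝ :=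
  ∑ v : V, ∑ t ∈ Finset.range n, (bestMean ν - armMean ν (action Φ x t v))

end

/-- Stochastic rewards: the entries of the random reward table are independent over all users, arms
and rounds, and the rewards of arm `i` have law `ν i`. -/
structure IsStochasticReward {V Ω : Type*} [MeasurableSpace Ω] (μ : Measure Ω) {K : ℕ}
    (ν : Fin K → Measure ℝ) (X : Ω → RewardTable V K) : Prop where
  law : ∀ v i t, HasLaw (fun ω => X ω v i t) (ν i) μ
  indep : iIndepFun (fun (p : V × Fin K × ℕ) ω => X ω p.1 p.2.1 p.2.2) μ

/-!
The users of a component form a team: from the second round on, the followers repeat the previous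
action of their leader `d`, and `d` bases its indices on the samples of the whole team. Given the
past, the rewards of a round are independent of the choices of the arms, so that for every fixed `l`
the process `exp (l * (R - ρ * N) - N * l ^ 2 / 8)`, with `N` the number of samples of an arm of
mean `ρ` and `R` the sum of their rewards, is a supermartingale. Markov's inequality gives
Hoeffding's bound on each event `N = k`. Because the number of samples of the team after `t` rounds
is determined by the leader's counts after `t - 1` and `t` rounds, it takes at most `2 * t` values,
and a union bound over them controls the deviation of the empirical mean with probability at least
`1 - 2 * t / t ^ 4`, without any loss depending on the size of the team.

If the leader chooses a suboptimal arm `i` of which the team has `8 log n / Δᵢ ^ 2` samples, then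
the empirical mean of `i` or that of an optimal arm deviates; this happens at most once in
expectation. Such a choice costs at most one sample for each member of the team. Otherwise the count
of the team exceeds `8 log n / Δᵢ ^ 2` by at most `2 * m - 1` for a team of `m` users, because of
the delay of one round and of the random first actions.
-/

open Finset
open scoped ENNReal NNReal

section Run

variable {V : Type*} {G : SimpleGraph V} {K : ℕ} (Φ : (v : V) → UserPolicy G K v)
  (x : RewardTable V K)

/-- What user `v` has observed after `t` rounds of the run of `Φ` on the rewards `x`. -/
def observed (t : ℕ) (v : V) : History G K v t :=
  fun s u => play Φ x s u

theorem action_eq (t : ℕ) (v : V) : action Φ x t v = Φ v t (observed Φ x t v) := by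
  rw [action, play]
  rfl

theorem play_eq (t : ℕ) (v : V) : play Φ x t v = (action Φ x t v, x v (action Φ x t v) t) := by
  rw [action, play]

theorem action_zero_eq (y : RewardTable V K) (v : V) : action Φ x 0 v = action Φ y 0 v := by
  rw [action_eq, action_eq]
  congr 1
  exact Subsingleton.elim _ _

/-- The reward table that agrees with `x` in the first `t` rounds and vanishes afterwards. As the
run up to round `t` is a function of it, it stands for the past of round number `t + 1`. -/
def truncate (t : ℕ) (x : RewardTable V K) : RewardTable V K :=
  fun v i s => if s < t then x v i s else 0

@[fun_prop]
theorem measurable_truncate (t : ℕ) : Measurable (truncate (V := V) (K := K) t) := by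
  refine measurable_pi_lambda _ fun v => measurable_pi_lambda _ fun i =>
    measurable_pi_lambda _ fun s => ?_
  unfold truncate
  split_ifs <;> fun_prop

theorem action_truncate {s t : ℕ} (hst : s ≤ t) (v : V) :
    action Φ (truncate t x) s v = action Φ x s v := by
  induction s using Nat.strong_induction_on generalizing v with
  | _ s ih =>
    rw [action_eq, action_eq]
    congr 1
    funext r u
    simp only [observed, play_eq, ih r r.2 (r.2.le.trans hst), truncate, if_pos (r.2.trans_le hst)]

variable {Φ}

theorem measurable_action (hΦ : ∀ v t, Measurable (Φ v t)) (t : ℕ) (v : V) :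
    Measurable fun x => action Φ x t v := by
  induction t using Nat.strong_induction_on generalizing v with
  | _ t ih =>
    simp only [action_eq]
    refine (hΦ v t).comp (measurable_pi_lambda _ fun s => measurable_pi_lambda _ fun u => ?_)
    have hu : Measurable fun x => action Φ x s u := ih s s.2 u
    have hreward : Measurable fun p : Fin K × RewardTable V K => p.2 u p.1 s :=
      measurable_from_prod_countable_right fun i => by dsimp only; fun_prop
    simp only [observed, play_eq]
    exact hu.prodMk (hreward.comp (hu.prodMk measurable_id))

end Run

section Pulls

variable {V : Type*} {G : SimpleGraph V} {K : ℕ} (Φ : (v : V) → UserPolicy G K v)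
  (x : RewardTable V K) (t : ℕ) (S : Finset V) (i : Fin K)

/-- The users in `S` that choose arm `i` in round number `t + 1`. -/
def pullers : Finset V :=
  {v ∈ S | action Φ x t v = i}

/-- The number `m_i(t)` of times that arm `i` is chosen by the users in `S` in the first `t`
rounds. -/
def pullCount : ℕ :=
  ∑ s ∈ range t, #(pullers Φ x s S i)

/-- The sum of the rewards that the users in `S` obtain from arm `i` in the first `t` rounds. -/
noncomputable def rewardSum : ℝ :=
  ∑ s ∈ range t, ∑ v ∈ pullers Φ x s S i, x v i s

theorem pullers_truncate {s t : ℕ} (hst : s ≤ t) :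
    pullers Φ (truncate t x) s S i = pullers Φ x s S i := by
  simp only [pullers, action_truncate Φ x hst]

theorem pullCount_truncate : pullCount Φ (truncate t x) t S i = pullCount Φ x t S i :=
  sum_congr rfl fun s hs => by rw [pullers_truncate Φ x S i (mem_range.1 hs).le]

theorem rewardSum_truncate : rewardSum Φ (truncate t x) t S i = rewardSum Φ x t S i := by
  refine sum_congr rfl fun s hs => ?_
  simp only [pullers_truncate Φ x S i (mem_range.1 hs).le, truncate, if_pos (mem_range.1 hs)]

theorem pullCount_succ :
    pullCount Φ x (t + 1) S i = pullCount Φ x t S i + #(pullers Φ x t S i) :=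
  sum_range_succ _ _

theorem rewardSum_succ :
    rewardSum Φ x (t + 1) S i = rewardSum Φ x t S i + ∑ v ∈ pullers Φ x t S i, x v i t :=
  sum_range_succ _ _

theorem pullCount_le : pullCount Φ x t S i ≤ t * #S := by
  simpa [pullCount, pullers] using sum_le_card_nsmul (range t) _ #S fun s _ => card_filter_le S _

theorem pullCount_mono : Monotone fun t => pullCount Φ x t S i :=
  fun _ _ h => sum_le_sum_of_subset (range_mono h)

variable {Φ} (hΦ : ∀ v t, Measurable (Φ v t))
include hΦ

theorem measurable_pullCount : Measurable fun x => pullCount Φ x t S i := by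
  simp only [pullCount, pullers, card_filter]
  exact measurable_sum _ fun s _ => measurable_sum _ fun v _ =>
    .ite (measurable_action hΦ s v (measurableSet_singleton i)) measurable_const measurable_const

theorem measurable_rewardSum : Measurable fun x => rewardSum Φ x t S i := by
  simp only [rewardSum, pullers, sum_filter]
  exact measurable_sum _ fun s _ => measurable_sum _ fun v _ =>
    .ite (measurable_action hΦ s v (measurableSet_singleton i)) (by fun_prop) measurable_const

theorem integrable_pullCount (μ : Measure (RewardTable V K)) [IsFiniteMeasure μ] :
    Integrable (fun x => (pullCount Φ x t S i : ℝ)) μ := by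
  refine .of_bound (C := (t * #S : ℕ))
    (measurable_from_top.comp (measurable_pullCount t S i hΦ)).aestronglyMeasurable
    (.of_forall fun x => ?_)
  rw [Real.norm_natCast]
  exact_mod_cast pullCount_le Φ x t S i

end Pulls

section Independence

theorem lintegral_mul_le_of_indepFun {Ω 𝓨 𝓩 : Type*} [MeasurableSpace Ω] [MeasurableSpace 𝓨]
    [MeasurableSpace 𝓩] {μ : Measure Ω} [IsFiniteMeasure μ] {Y : Ω → 𝓨} {Z : Ω → 𝓩}
    (hY : AEMeasurable Y μ) (hZ : AEMeasurable Z μ) (hYZ : IndepFun Y Z μ)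
    {f : 𝓨 → ℝ≥0∞} (hf : Measurable f) {g : 𝓨 → 𝓩 → ℝ≥0∞} (hg : Measurable (Function.uncurry g))
    (hg1 : ∀ y, ∫⁻ ω, g y (Z ω) ∂μ ≤ 1) :
    ∫⁻ ω, f (Y ω) * g (Y ω) (Z ω) ∂μ ≤ ∫⁻ ω, f (Y ω) ∂μ := by
  have hfg : Measurable fun p : 𝓨 × 𝓩 => f p.1 * g p.1 p.2 := (hf.comp measurable_fst).mul hg
  have hgy (y : 𝓨) : Measurable (g y) := hg.comp measurable_prodMk_left
  calc ∫⁻ ω, f (Y ω) * g (Y ω) (Z ω) ∂μ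
      = ∫⁻ p, f p.1 * g p.1 p.2 ∂(μ.map Y).prod (μ.map Z) := by
        rw [← hYZ.map_prod_eq_prod_map_map hY hZ, lintegral_map' hfg.aemeasurable (hY.prodMk hZ)]
    _ = ∫⁻ y, f y * ∫⁻ z, g y z ∂μ.map Z ∂μ.map Y := by
        rw [lintegral_prod _ hfg.aemeasurable]
        simp only [lintegral_const_mul _ (hgy _)]
    _ ≤ ∫⁻ y, f y ∂μ.map Y := by
        refine lintegral_mono fun y => mul_le_of_le_one_right' ?_
        rw [lintegral_map' (hgy y).aemeasurable hZ]
        exact hg1 y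
    _ = ∫⁻ ω, f (Y ω) ∂μ := lintegral_map' hf.aemeasurable hY

theorem integral_le_of_indepFun_of_forall_le {Ω α 𝓨 : Type*} [MeasurableSpace Ω] [Finite α]
    [MeasurableSpace α] [MeasurableSingletonClass α] [MeasurableSpace 𝓨] {μ : Measure Ω}
    [IsProbabilityMeasure μ] {A : Ω → α} {Y : Ω → 𝓨} (hA : AEMeasurable A μ)
    (hY : AEMeasurable Y μ) (hAY : IndepFun A Y μ) {F : α → 𝓨 → ℝ} (hF : ∀ a, Measurable (F a))
    (hFi : ∀ a, Integrable (F a) (μ.map Y)) {B : ℝ} (hB : ∀ a, ∫ y, F a y ∂μ.map Y ≤ B) :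
    Integrable (fun ω => F (A ω) (Y ω)) μ ∧ ∫ ω, F (A ω) (Y ω) ∂μ ≤ B := by
  have hFm : Measurable (Function.uncurry F) := measurable_from_prod_countable_right hF
  have hmap : μ.map (fun ω => (A ω, Y ω)) = (μ.map A).prod (μ.map Y) :=
    hAY.map_prod_eq_prod_map_map hA hY
  have := Measure.isProbabilityMeasure_map hA
  have := Measure.isProbabilityMeasure_map hY
  have hint : Integrable (Function.uncurry F) ((μ.map A).prod (μ.map Y)) :=
    (integrable_prod_iff hFm.aestronglyMeasurable).2 ⟨.of_forall hFi, .of_finite⟩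
  refine ⟨(hmap ▸ hint).comp_aemeasurable (hA.prodMk hY), ?_⟩
  calc ∫ ω, F (A ω) (Y ω) ∂μ = ∫ p, Function.uncurry F p ∂(μ.map A).prod (μ.map Y) := by
        rw [← hmap, integral_map (hA.prodMk hY) hFm.aestronglyMeasurable]
        rfl
    _ = ∫ a, ∫ y, F a y ∂μ.map Y ∂μ.map A := integral_prod _ hint
    _ ≤ ∫ _, B ∂μ.map A := integral_mono .of_finite (integrable_const B) hB
    _ = B := by simp

variable {V Ω : Type*} [MeasurableSpace Ω] {K : ℕ} {ν : Fin K → Measure ℝ}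

theorem IsStochasticReward.aemeasurable [Countable V] {μ : Measure Ω} {X : Ω → RewardTable V K}
    (hX : IsStochasticReward μ ν X) : AEMeasurable X μ :=
  aemeasurable_pi_iff.2 fun v => aemeasurable_pi_iff.2 fun i => aemeasurable_pi_iff.2 fun t =>
    (hX.law v i t).aemeasurable

theorem IsStochasticReward.map [Countable V] {μ : Measure Ω} [IsProbabilityMeasure μ]
    {X : Ω → RewardTable V K} (hX : IsStochasticReward μ ν X) :
    IsStochasticReward (μ.map X) ν id where
  law v i t := by
    have heval : Measurable fun x : RewardTable V K => x v i t := by fun_prop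
    refine ⟨heval.aemeasurable, ?_⟩
    rw [← (hX.law v i t).map_eq]
    exact AEMeasurable.map_map_of_aemeasurable heval.aemeasurable hX.aemeasurable
  indep := by
    have := Measure.isProbabilityMeasure_map hX.aemeasurable
    have heval (p : V × Fin K × ℕ) :
        Measurable fun x : RewardTable V K => x p.1 p.2.1 p.2.2 := by fun_prop
    refine (iIndepFun_iff_map_fun_eq_infinitePi_map₀'
      (X := fun (p : V × Fin K × ℕ) (x : RewardTable V K) => x p.1 p.2.1 p.2.2)
      fun p => (heval p).aemeasurable).2 ?_
    have h := (iIndepFun_iff_map_fun_eq_infinitePi_map₀'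
      fun (p : V × Fin K × ℕ) => (hX.law p.1 p.2.1 p.2.2).aemeasurable).1 hX.indep
    have hall : Measurable fun (x : RewardTable V K) (p : V × Fin K × ℕ) => x p.1 p.2.1 p.2.2 := by
      fun_prop
    rw [AEMeasurable.map_map_of_aemeasurable hall.aemeasurable hX.aemeasurable]
    simp only [AEMeasurable.map_map_of_aemeasurable (heval _).aemeasurable hX.aemeasurable]
    exact h

theorem indepFun_truncate_eval [Finite V] {μ : Measure (RewardTable V K)}
    (hμ : IsStochasticReward μ ν id) (t : ℕ) (i : Fin K) :
    IndepFun (truncate t) (fun x v => x v i t) μ := by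
  classical
  cases nonempty_fintype V
  let past : Finset (V × Fin K × ℕ) := univ ×ˢ univ ×ˢ range t
  let present : Finset (V × Fin K × ℕ) := univ ×ˢ univ ×ˢ {t}
  have hdisj : Disjoint past present := by
    simp only [past, present, disjoint_product, disjoint_singleton_right, mem_range, lt_irrefl,
      not_false_eq_true, or_true]
  let extend (y : past → ℝ) : RewardTable V K := fun v j s =>
    if h : (v, j, s) ∈ past then y ⟨(v, j, s), h⟩ else 0
  have hextend : Measurable extend := by
    refine measurable_pi_lambda _ fun v => measurable_pi_lambda _ fun j =>
      measurable_pi_lambda _ fun s => ?_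
    by_cases h : (v, j, s) ∈ past <;> simp only [extend, h, dite_true, dite_false] <;> fun_prop
  let row (y : present → ℝ) (v : V) : ℝ := y ⟨(v, i, t), by simp [present]⟩
  have hrow : Measurable row := by fun_prop
  convert (hμ.indep.indepFun_finset past present hdisj fun p => by
    simp only [id]; fun_prop).comp hextend hrow using 1
  · funext x v j s
    simp [truncate, extend, past]
  · rfl

end Independence

section Concentration

theorem lintegral_exp_le_one {Ω : Type*} [MeasurableSpace Ω] {μ : Measure Ω} {Y : Ω → ℝ} {σ : ℝ≥0}
    (hY : HasSubgaussianMGF Y σ μ) (l : ℝ) :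
    ∫⁻ ω, ENNReal.ofReal (Real.exp (l * Y ω - σ * l ^ 2 / 2)) ∂μ ≤ 1 := by
  have hint : Integrable (fun ω => Real.exp (l * Y ω - σ * l ^ 2 / 2)) μ := by
    simpa only [Real.exp_sub] using (hY.integrable_exp_mul l).div_const _
  rw [← ofReal_integral_eq_lintegral_ofReal hint (.of_forall fun ω => (Real.exp_pos _).le)]
  simp only [Real.exp_sub, integral_div]
  exact ENNReal.ofReal_le_one.2 ((div_le_one (Real.exp_pos _)).2 (hY.mgf_le l))

variable {V : Type*} {G : SimpleGraph V} {K : ℕ} {μ : Measure (RewardTable V K)}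
  {ν : Fin K → Measure ℝ} {Φ : (v : V) → UserPolicy G K v} {i : Fin K} {σ : ℝ≥0}

theorem hasSubgaussianMGF_sum_reward (hμ : IsStochasticReward μ ν id)
    (hi : HasSubgaussianMGF (fun y => y - armMean ν i) σ (ν i)) (t : ℕ) (B : Finset V) :
    HasSubgaussianMGF (fun x => ∑ v ∈ B, (x v i t - armMean ν i)) (#B * σ) μ := by
  have hindep : iIndepFun (fun v (x : RewardTable V K) => x v i t - armMean ν i) μ :=
    (hμ.indep.precomp (g := fun v : V => (v, i, t)) fun v w h => (Prod.ext_iff.1 h).1).comp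
      (fun _ y => y - armMean ν i) fun _ => by fun_prop
  have hreward (v : V) : HasSubgaussianMGF (fun x => x v i t - armMean ν i) σ μ :=
    .of_map (X := fun y => y - armMean ν i) (hμ.law v i t).aemeasurable
      ((hμ.law v i t).map_eq ▸ hi)
  simpa using HasSubgaussianMGF.sum_of_iIndepFun hindep (s := B) fun v _ => hreward v

variable (Φ) in
/-- The exponential supermartingale of Hoeffding's inequality for the samples that the users in `S`
have drawn from arm `i` in the first `t` rounds, where `ρ` is the mean of the arm and `σ` the
variance proxy of its rewards. -/
noncomputable def hoeffdingProcess (ρ : ℝ) (σ : ℝ≥0) (l : ℝ) (x : RewardTable V K) (t : ℕ)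
    (S : Finset V) (i : Fin K) : ℝ :=
  Real.exp (l * (rewardSum Φ x t S i - ρ * pullCount Φ x t S i)
    - pullCount Φ x t S i * σ * l ^ 2 / 2)

theorem hoeffdingProcess_succ (ρ l : ℝ) (x : RewardTable V K) (t : ℕ) (S : Finset V) :
    hoeffdingProcess Φ ρ σ l x (t + 1) S i = hoeffdingProcess Φ ρ σ l x t S i *
      Real.exp (l * ∑ v ∈ pullers Φ x t S i, (x v i t - ρ)
        - #(pullers Φ x t S i) * σ * l ^ 2 / 2) := by
  rw [hoeffdingProcess, hoeffdingProcess, ← Real.exp_add, rewardSum_succ, pullCount_succ,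
    sum_sub_distrib, sum_const, nsmul_eq_mul, Nat.cast_add]
  ring_nf

theorem hoeffdingProcess_truncate (ρ l : ℝ) (x : RewardTable V K) (t : ℕ) (S : Finset V) :
    hoeffdingProcess Φ ρ σ l (truncate t x) t S i = hoeffdingProcess Φ ρ σ l x t S i := by
  rw [hoeffdingProcess, hoeffdingProcess, pullCount_truncate, rewardSum_truncate]

theorem measurable_hoeffdingProcess (hΦ : ∀ v t, Measurable (Φ v t)) (ρ l : ℝ) (t : ℕ)
    (S : Finset V) : Measurable fun x => hoeffdingProcess Φ ρ σ l x t S i := by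
  have := measurable_pullCount t S i hΦ
  have := measurable_rewardSum t S i hΦ
  unfold hoeffdingProcess
  fun_prop

variable [Finite V]

theorem lintegral_hoeffdingProcess_le_one [IsProbabilityMeasure μ] (hΦ : ∀ v t, Measurable (Φ v t))
    (hμ : IsStochasticReward μ ν id)
    (hi : HasSubgaussianMGF (fun y => y - armMean ν i) σ (ν i)) (l : ℝ) (t : ℕ) (S : Finset V) :
    ∫⁻ x, ENNReal.ofReal (hoeffdingProcess Φ (armMean ν i) σ l x t S i) ∂μ ≤ 1 := by
  induction t with
  | zero => simp [hoeffdingProcess, pullCount, rewardSum]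
  | succ t ih =>
    let f (y : RewardTable V K) := ENNReal.ofReal (hoeffdingProcess Φ (armMean ν i) σ l y t S i)
    let g (y : RewardTable V K) (z : V → ℝ) := ENNReal.ofReal (Real.exp
      (l * ∑ v ∈ pullers Φ y t S i, (z v - armMean ν i) - #(pullers Φ y t S i) * σ * l ^ 2 / 2))
    have hf : Measurable f := (measurable_hoeffdingProcess hΦ _ l t S).ennreal_ofReal
    have hg : Measurable (Function.uncurry g) := by
      have hpull (v : V) : MeasurableSet {p : RewardTable V K × (V → ℝ) | action Φ p.1 t v = i} :=
        ((measurable_action hΦ t v).comp measurable_fst) (measurableSet_singleton i)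
      have hcard : Measurable fun p : RewardTable V K × (V → ℝ) => #(pullers Φ p.1 t S i) := by
        simp only [pullers, card_filter]
        exact measurable_sum _ fun v _ => .ite (hpull v) measurable_const measurable_const
      have hsum : Measurable fun p : RewardTable V K × (V → ℝ) =>
          ∑ v ∈ pullers Φ p.1 t S i, (p.2 v - armMean ν i) := by
        simp only [pullers, sum_filter]
        exact measurable_sum _ fun v _ => .ite (hpull v) (by fun_prop) measurable_const
      unfold g Function.uncurry
      fun_prop
    have hg1 (y : RewardTable V K) : ∫⁻ x, g y (fun v => x v i t) ∂μ ≤ 1 := by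
      simpa [g] using lintegral_exp_le_one
        (hasSubgaussianMGF_sum_reward hμ hi t (pullers Φ y t S i)) l
    have hrow : Measurable fun (x : RewardTable V K) v => x v i t := by fun_prop
    calc ∫⁻ x, ENNReal.ofReal (hoeffdingProcess Φ (armMean ν i) σ l x (t + 1) S i) ∂μ
        = ∫⁻ x, f (truncate t x) * g (truncate t x) (fun v => x v i t) ∂μ := by
          refine lintegral_congr fun x => ?_
          rw [hoeffdingProcess_succ, ENNReal.ofReal_mul' (Real.exp_pos _).le]
          simp only [f, g, hoeffdingProcess_truncate, pullers_truncate Φ x S i le_rfl]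
      _ ≤ ∫⁻ x, f (truncate t x) ∂μ := lintegral_mul_le_of_indepFun
          (measurable_truncate t).aemeasurable hrow.aemeasurable
          (indepFun_truncate_eval hμ t i) hf hg hg1
      _ ≤ 1 := by simpa only [f, hoeffdingProcess_truncate] using ih

theorem measureReal_pullCount_eq_and_deviation_le [IsProbabilityMeasure μ]
    (hΦ : ∀ v t, Measurable (Φ v t)) (hμ : IsStochasticReward μ ν id)
    (hi : HasSubgaussianMGF (fun y => y - armMean ν i) σ (ν i)) (t N : ℕ) (S : Finset V)
    {ε s : ℝ} (hε : 0 ≤ ε) (hs : s ^ 2 = 1) :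
    μ.real {x | pullCount Φ x t S i = N ∧ ε ≤ s * (rewardSum Φ x t S i - armMean ν i * N)} ≤
      Real.exp (-(ε ^ 2 / (2 * N * σ))) := by
  -- Up to the sign `s`, this is the maximizer of `l * ε - N * σ * l ^ 2 / 2`.
  set l := s * (ε / (N * σ))
  set r := ε ^ 2 / (2 * N * σ)
  have hsub : {x | pullCount Φ x t S i = N ∧ ε ≤ s * (rewardSum Φ x t S i - armMean ν i * N)} ⊆
      {x | ENNReal.ofReal (Real.exp r) ≤
        ENNReal.ofReal (hoeffdingProcess Φ (armMean ν i) σ l x t S i)} := by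
    rintro x ⟨hN, hdev⟩
    refine ENNReal.ofReal_le_ofReal (Real.exp_le_exp.2 ?_)
    have hquad : N * σ * l ^ 2 / 2 = r := by
      rcases eq_or_ne (N * σ : ℝ) 0 with hzero | hne
      · simp [r, mul_assoc, hzero]
      · simp only [l, r, mul_pow, hs]
        field_simp [hne]
    have hlin : 2 * r ≤ l * (rewardSum Φ x t S i - armMean ν i * N) :=
      calc 2 * r = ε / (N * σ) * ε := by ring
        _ ≤ ε / (N * σ) * (s * (rewardSum Φ x t S i - armMean ν i * N)) := by gcongr
        _ = l * (rewardSum Φ x t S i - armMean ν i * N) := by ring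
    rw [hN]
    linarith
  have hmarkov := mul_meas_ge_le_lintegral (μ := μ)
    (measurable_hoeffdingProcess (σ := σ) (i := i) hΦ (armMean ν i) l t S).ennreal_ofReal
    (ENNReal.ofReal (Real.exp r))
  refine ENNReal.toReal_le_of_le_ofReal (Real.exp_pos _).le ((measure_mono hsub).trans ?_)
  rw [Real.exp_neg, ENNReal.ofReal_inv_of_pos (Real.exp_pos _), ENNReal.le_inv_iff_mul_le, mul_comm]
  exact hmarkov.trans (lintegral_hoeffdingProcess_le_one hΦ hμ hi l t S)

theorem measureReal_deviation_le_of_forall_mem [IsProbabilityMeasure μ]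
    (hΦ : ∀ v t, Measurable (Φ v t)) (hμ : IsStochasticReward μ ν id)
    (hi : HasSubgaussianMGF (fun y => y - armMean ν i) 4⁻¹ (ν i)) {t : ℕ} (ht : 1 ≤ t)
    {S : Finset V} {𝒩 : Finset ℕ} (h𝒩 : 0 ∉ 𝒩) (hcount : ∀ x, pullCount Φ x t S i ∈ 𝒩) {s : ℝ}
    (hs : s ^ 2 = 1) :
    μ.real {x | √(2 * pullCount Φ x t S i * Real.log t) ≤
      s * (rewardSum Φ x t S i - armMean ν i * pullCount Φ x t S i)} ≤ #𝒩 / (t : ℝ) ^ 4 := by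
  let E (N : ℕ) := {x | pullCount Φ x t S i = N ∧
    √(2 * N * Real.log t) ≤ s * (rewardSum Φ x t S i - armMean ν i * N)}
  have hE (N : ℕ) (hN : N ∈ 𝒩) : μ.real (E N) ≤ 1 / (t : ℝ) ^ 4 := by
    have ht0 : (0 : ℝ) < t := by exact_mod_cast ht
    have hN0 : (N : ℝ) ≠ 0 := by exact_mod_cast ne_of_mem_of_not_mem hN h𝒩
    refine (measureReal_pullCount_eq_and_deviation_le hΦ hμ hi t N S (Real.sqrt_nonneg _)
      hs).trans_eq ?_
    have hexponent : √(2 * N * Real.log t) ^ 2 / (2 * N * (4⁻¹ : ℝ≥0)) = Real.log (t ^ 4) := by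
      rw [Real.sq_sqrt (mul_nonneg (by positivity) (Real.log_natCast_nonneg t)), Real.log_pow]
      push_cast
      field_simp
    rw [hexponent, Real.exp_neg, Real.exp_log (pow_pos ht0 4), one_div]
  calc _ ≤ μ.real (⋃ N ∈ 𝒩, E N) :=
        measureReal_mono (fun x hx => Set.mem_biUnion (hcount x) ⟨rfl, hx⟩) (measure_ne_top _ _)
    _ ≤ ∑ N ∈ 𝒩, μ.real (E N) := measureReal_biUnion_finset_le 𝒩 E
    _ ≤ #𝒩 • (1 / (t : ℝ) ^ 4) := sum_le_card_nsmul 𝒩 _ _ hE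
    _ = #𝒩 / (t : ℝ) ^ 4 := by rw [nsmul_eq_mul, mul_one_div]

end Concentration

section Team

variable {V : Type*} {G : SimpleGraph V} {K : ℕ}

/-- The members of the team `S` other than `d` repeat in every round the previous action of their
leader `d`, who belongs to the team. -/
structure FollowsLeader (Φ : (v : V) → UserPolicy G K v) (S : Finset V) (d : V) : Prop where
  leader_mem : d ∈ S
  action_succ : ∀ v ∈ S, v ≠ d → ∀ x t, action Φ x (t + 1) v = action Φ x t d

/-- A team whose leader `d` observes all of its members and applies UCB-user to their samples. -/
structure IsUCBTeam [Fintype V] (Φ : (v : V) → UserPolicy G K v) (S : Finset V) (d : V) : Prop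
    extends FollowsLeader Φ S d where
  mem_closedNbhd : ∀ v ∈ S, v = d ∨ G.Adj d v
  isUCBUser : IsUCBUser (S : Set V) (Φ d)

variable {Φ : (v : V) → UserPolicy G K v} {S : Finset V} {d : V}

theorem card_pullers_singleton (x : RewardTable V K) (t : ℕ) (i : Fin K) :
    #(pullers Φ x t {d} i) = if action Φ x t d = i then 1 else 0 := by
  simp only [pullers, card_filter, sum_singleton]

theorem pullers_zero_eq (x y : RewardTable V K) (i : Fin K) :
    pullers Φ x 0 S i = pullers Φ y 0 S i := by
  simp only [pullers, action_zero_eq Φ x y]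

namespace FollowsLeader

variable [DecidableEq V] (h : FollowsLeader Φ S d) (x : RewardTable V K) (t : ℕ) (i : Fin K)
include h

theorem pullCount_succ_eq : pullCount Φ x (t + 1) S i = #(pullers Φ x 0 (S.erase d) i) +
    (#S - 1) * pullCount Φ x t {d} i + pullCount Φ x (t + 1) {d} i := by
  have hsplit (s : ℕ) :
      #(pullers Φ x s S i) = #(pullers Φ x s (S.erase d) i) + #(pullers Φ x s {d} i) := by
    simp only [pullers, card_filter, sum_singleton, sum_erase_add S _ h.leader_mem]
  have hfollow (s : ℕ) :
      #(pullers Φ x (s + 1) (S.erase d) i) = (#S - 1) * #(pullers Φ x s {d} i) := by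
    rw [card_pullers_singleton, ← card_erase_of_mem h.leader_mem, pullers, card_filter,
      ← smul_eq_mul, ← sum_const]
    exact sum_congr rfl fun v hv => by
      rw [h.action_succ v (mem_of_mem_erase hv) (ne_of_mem_erase hv)]
  simp only [pullCount, hsplit, sum_add_distrib, mul_sum,
    sum_range_succ' (fun s => #(pullers Φ x s (S.erase d) i)), hfollow]
  ring

theorem card_pullers_erase_lt_card : #(pullers Φ x t (S.erase d) i) < #S :=
  (card_filter_le _ _).trans_lt (card_erase_lt_of_mem h.leader_mem)

theorem le_pullCount_add_card : #(pullers Φ x 0 (S.erase d) i) + #S * pullCount Φ x t {d} i + 1 ≤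
    pullCount Φ x t S i + #S := by
  have hlt := h.card_pullers_erase_lt_card x 0 i
  cases t with
  | zero => simp only [pullCount, range_zero, sum_empty]; omega
  | succ t =>
    obtain ⟨r, hr⟩ : ∃ r, #S = r + 1 := ⟨#S - 1, by omega⟩
    rw [h.pullCount_succ_eq, hr, pullCount_succ Φ x t {d}, card_pullers_singleton,
      Nat.add_sub_cancel]
    split_ifs <;> linarith

theorem pullCount_le_add_mul : pullCount Φ x t S i ≤
    #(pullers Φ x 0 (S.erase d) i) + #S * pullCount Φ x t {d} i := by
  cases t with
  | zero => simp [pullCount]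
  | succ t =>
    obtain ⟨r, hr⟩ : ∃ r, #S = r + 1 :=
      ⟨#S - 1, by have := h.card_pullers_erase_lt_card x 0 i; omega⟩
    rw [h.pullCount_succ_eq, hr, Nat.add_sub_cancel, add_mul, one_mul, ← add_assoc]
    gcongr
    exact pullCount_mono Φ x {d} i (Nat.le_succ t)

end FollowsLeader

theorem sum_closedNbhd_eq_sum {M : Type*} [AddCommMonoid M] {_ : Fintype (ClosedNbhd G d)}
    [DecidableEq V] (hS : ∀ v ∈ S, v = d ∨ G.Adj d v) (g : V → M) :
    ∑ u : ClosedNbhd G d, (if u.1 ∈ S then g u.1 else 0) = ∑ v ∈ S, g v := by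
  rw [← sum_filter]
  exact sum_nbij Subtype.val (fun u hu => (mem_filter.1 hu).2) Subtype.val_injective.injOn
    (fun v hv => ⟨⟨v, hS v hv⟩, by simpa using hv, rfl⟩) fun _ _ => rfl

variable [Fintype V]

theorem sampleCount_observed (hS : ∀ v ∈ S, v = d ∨ G.Adj d v) (x : RewardTable V K) (t : ℕ)
    (i : Fin K) : sampleCount S (observed Φ x t d) i = pullCount Φ x t S i := by
  classical
  simp only [sampleCount, pullCount, pullers, card_filter, ite_and, mem_coe, observed]
  rw [← Fin.sum_univ_eq_sum_range]
  refine sum_congr rfl fun s _ => ?_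
  exact sum_closedNbhd_eq_sum hS fun v => if action Φ x s v = i then 1 else 0

theorem sampleMean_observed (hS : ∀ v ∈ S, v = d ∨ G.Adj d v) (x : RewardTable V K) (t : ℕ)
    (i : Fin K) :
    sampleMean S (observed Φ x t d) i = rewardSum Φ x t S i / pullCount Φ x t S i := by
  classical
  rw [sampleMean, sampleCount_observed hS]
  simp only [rewardSum, pullers, sum_filter, ite_and, mem_coe, observed, play_eq]
  rw [← Fin.sum_univ_eq_sum_range]
  congr 1
  refine sum_congr rfl fun s _ => ?_
  rw [← sum_closedNbhd_eq_sum hS fun v => if action Φ x s v = i then x v i s else 0]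
  refine sum_congr rfl fun u _ => ?_
  congr 1
  split_ifs with hi
  · rw [hi]
  · rfl

namespace IsUCBTeam

variable (h : IsUCBTeam Φ S d) (x : RewardTable V K) {t : ℕ} {i : Fin K}
include h

theorem action_leader_of_lt (ht : t < K) : action Φ x t d = ⟨t, ht⟩ := by
  rw [action_eq, h.isUCBUser.initialization t ht]

theorem index_le_index (ht : K ≤ t) (hi : action Φ x t d = i) (j : Fin K) :
    rewardSum Φ x t S j / pullCount Φ x t S j + √(2 * Real.log t / pullCount Φ x t S j) ≤
      rewardSum Φ x t S i / pullCount Φ x t S i + √(2 * Real.log t / pullCount Φ x t S i) := by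
  have := h.isUCBUser.loop t ht (observed Φ x t d) j
  rwa [← action_eq Φ x, hi, ucbIndex, ucbIndex, sampleMean_observed h.mem_closedNbhd,
    sampleMean_observed h.mem_closedNbhd, sampleCount_observed h.mem_closedNbhd,
    sampleCount_observed h.mem_closedNbhd] at this

theorem pullCount_leader_eq_zero (ht : t ≤ i) : pullCount Φ x t {d} i = 0 := by
  refine sum_eq_zero fun s hs => ?_
  have hsi := (mem_range.1 hs).trans_le ht
  rw [card_pullers_singleton, h.action_leader_of_lt x (hsi.trans i.2), if_neg]
  exact fun hs => hsi.ne (congrArg Fin.val hs)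

theorem one_le_pullCount_leader (i : Fin K) (ht : K ≤ t) : 1 ≤ pullCount Φ x t {d} i :=
  calc 1 = pullCount Φ x (i + 1) {d} i := by
        rw [pullCount_succ, h.pullCount_leader_eq_zero x le_rfl, card_pullers_singleton,
          h.action_leader_of_lt x i.2, if_pos rfl]
    _ ≤ pullCount Φ x t {d} i := pullCount_mono Φ x {d} i (i.2.trans_le ht)

/-- The leader's counts after `t - 1` and `t` rounds determine the count of the team. -/
theorem exists_finset_forall_pullCount_mem (i : Fin K) (ht : K ≤ t) :
    ∃ 𝒩 : Finset ℕ, #𝒩 ≤ t * 2 ∧ 0 ∉ 𝒩 ∧ ∀ x, pullCount Φ x t S i ∈ 𝒩 := by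
  classical
  obtain ⟨s, rfl⟩ : ∃ s, t = s + 1 := ⟨t - 1, by have := i.pos; omega⟩
  let count (p : ℕ × ℕ) := #(pullers Φ 0 0 (S.erase d) i) + (#S - 1) * (p.1 + p.2) + (p.1 + 1)
  refine ⟨(range (s + 1) ×ˢ range 2).image count, ?_, ?_, fun x => ?_⟩
  · exact card_image_le.trans_eq (by rw [card_product, card_range, card_range])
  · simp [count]
  · have hpos := h.one_le_pullCount_leader x i ht
    have hle := pullCount_le Φ x (s + 1) {d} i
    have hsucc := pullCount_succ Φ x s {d} i
    have hpull := card_filter_le {d} fun v => action Φ x s v = i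
    rw [← pullers] at hpull
    rw [card_singleton] at hle hpull
    refine mem_image.2 ⟨(pullCount Φ x (s + 1) {d} i - 1, 1 - #(pullers Φ x s {d} i)),
      mem_product.2 ⟨mem_range.2 (by omega), mem_range.2 (by omega)⟩, ?_⟩
    simp only [count]
    rw [h.pullCount_succ_eq, pullers_zero_eq 0 x]
    congr 2
    · congr 1; omega
    · omega

end IsUCBTeam

end Team

section Oversampling

variable {V : Type*} {G : SimpleGraph V} {K : ℕ}

/-- The event that in round number `t + 1`, after the initialization, the user `d` chooses arm `i`
although the users in `S` already have at least `L` samples of it. -/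
def oversampling (Φ : (v : V) → UserPolicy G K v) (S : Finset V) (d : V) (i : Fin K) (L : ℝ)
    (t : ℕ) : Set (RewardTable V K) :=
  {x | K ≤ t ∧ action Φ x t d = i ∧ L ≤ pullCount Φ x t S i}

variable {Φ : (v : V) → UserPolicy G K v} {S : Finset V} {d : V}

theorem oversampling_eq_empty {t : ℕ} (ht : t < K) (i : Fin K) (L : ℝ) :
    oversampling Φ S d i L t = ∅ :=
  Set.eq_empty_of_forall_notMem fun _ hx => ht.not_ge hx.1

theorem measurableSet_oversampling (hΦ : ∀ v t, Measurable (Φ v t)) (i : Fin K) (L : ℝ) (t : ℕ) :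
    MeasurableSet (oversampling Φ S d i L t) := by
  have hcount : Measurable fun x => (pullCount Φ x t S i : ℝ) :=
    measurable_from_top.comp (measurable_pullCount t S i hΦ)
  exact (MeasurableSet.const _).inter ((measurable_action hΦ t d (measurableSet_singleton i)).inter
    (measurableSet_le measurable_const hcount))

namespace IsUCBTeam

variable [Fintype V] (h : IsUCBTeam Φ S d) (x : RewardTable V K) (i : Fin K) {L : ℝ}
include h

theorem card_pullers_add_mul_pullCount_leader_le [DecidableEq V] (hL : 0 ≤ L) (n : ℕ) :
    (#(pullers Φ x 0 (S.erase d) i) + #S * pullCount Φ x n {d} i : ℝ) ≤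
      L + (2 * #S - 1) + #S * ∑ t ∈ range n, (oversampling Φ S d i L t).indicator 1 x := by
  have hfirst : (#(pullers Φ x 0 (S.erase d) i) + 1 : ℝ) ≤ #S := by
    exact_mod_cast h.card_pullers_erase_lt_card x 0 i
  have hsum (n : ℕ) : 0 ≤ (#S : ℝ) * ∑ t ∈ range n, (oversampling Φ S d i L t).indicator 1 x :=
    mul_nonneg (Nat.cast_nonneg _) <| sum_nonneg fun t _ =>
      Set.indicator_nonneg (fun _ _ => zero_le_one) x
  induction n with
  | zero =>
    simp only [pullCount, range_zero, sum_empty, Nat.cast_zero, mul_zero, add_zero]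
    linarith
  | succ t ih =>
    rw [pullCount_succ, card_pullers_singleton, sum_range_succ]
    by_cases hover : x ∈ oversampling Φ S d i L t
    · rw [if_pos hover.2.1, Set.indicator_of_mem hover]
      push_cast [Pi.one_apply]
      linarith
    rw [Set.indicator_of_notMem hover, add_zero]
    split_ifs with hi
    · rcases lt_or_ge t K with ht | ht
      · have hti : t ≤ i := (congrArg Fin.val ((h.action_leader_of_lt x ht).symm.trans hi)).le
        rw [h.pullCount_leader_eq_zero x hti]
        push_cast
        linarith [hsum t]
      · have hlt : (pullCount Φ x t S i : ℝ) < L := not_le.1 fun hL => hover ⟨ht, hi, hL⟩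
        have hle : (#(pullers Φ x 0 (S.erase d) i) + #S * pullCount Φ x t {d} i + 1 : ℝ) ≤
            pullCount Φ x t S i + #S := by
          exact_mod_cast h.le_pullCount_add_card x t i
        push_cast
        linarith [hsum t]
    · simpa using ih

theorem pullCount_le_add_sum_indicator (hL : 0 ≤ L) (n : ℕ) :
    (pullCount Φ x n S i : ℝ) ≤
      L + (2 * #S - 1) + #S * ∑ t ∈ range n, (oversampling Φ S d i L t).indicator 1 x := by
  classical
  refine le_trans ?_ (h.card_pullers_add_mul_pullCount_leader_le x i hL n)
  exact_mod_cast h.pullCount_le_add_mul x n i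

end IsUCBTeam

end Oversampling

section Gap

variable {K : ℕ} {ν : Fin K → Measure ℝ}

theorem gap_nonneg (ν : Fin K → Measure ℝ) (i : Fin K) : 0 ≤ gap ν i :=
  sub_nonneg.2 (le_ciSup (Set.finite_range (armMean ν)).bddAbove i)

theorem exists_armMean_eq_bestMean [Nonempty (Fin K)] (ν : Fin K → Measure ℝ) :
    ∃ j, armMean ν j = bestMean ν :=
  exists_eq_ciSup_of_finite

theorem two_le_of_gap_pos {i : Fin K} (hi : 0 < gap ν i) : 2 ≤ K := by
  have : Nonempty (Fin K) := ⟨i⟩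
  obtain ⟨j, hj⟩ := exists_armMean_eq_bestMean ν
  have hij : i ≠ j := fun hij => by rw [gap, hij, hj, sub_self] at hi; exact hi.false
  have : (i : ℕ) ≠ j := Fin.val_ne_of_ne hij
  omega

end Gap

section PullCountBound

theorem sqrt_two_mul_mul_eq {N : ℝ} (hN : 0 < N) (l : ℝ) : √(2 * N * l) = √(2 * l / N) * N := by
  rw [show 2 * N * l = 2 * l / N * N ^ 2 by field_simp, Real.sqrt_mul' _ (sq_nonneg N),
    Real.sqrt_sq hN.le]

-- The signs are written as factors `-1` and `1` in order to treat both tails of a sample at once.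
theorem deviation_of_index_le {R₀ R N₀ N ρ₀ ρ l : ℝ} (hN₀ : 0 < N₀) (hN : 0 < N)
    (hρ : ρ < ρ₀) (hl : 8 * l / (ρ₀ - ρ) ^ 2 ≤ N)
    (hindex : R₀ / N₀ + √(2 * l / N₀) ≤ R / N + √(2 * l / N)) :
    √(2 * N₀ * l) ≤ -1 * (R₀ - ρ₀ * N₀) ∨ √(2 * N * l) ≤ 1 * (R - ρ * N) := by
  have hgap : 0 < ρ₀ - ρ := sub_pos.2 hρ
  have hwidth : √(2 * l / N) ≤ (ρ₀ - ρ) / 2 := by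
    refine Real.sqrt_le_iff.2 ⟨by positivity, ?_⟩
    rw [div_le_iff₀ (by positivity)] at hl
    rw [div_le_iff₀ hN]
    linarith
  by_contra! hdev
  rw [sqrt_two_mul_mul_eq hN₀, sqrt_two_mul_mul_eq hN] at hdev
  have hmean : R / N < ρ + √(2 * l / N) := by
    rw [div_lt_iff₀ hN]
    linarith
  have hmean₀ : ρ₀ - √(2 * l / N₀) < R₀ / N₀ := by
    rw [lt_div_iff₀ hN₀]
    linarith
  linarith

theorem sum_Ico_four_div_cube_le_one (n : ℕ) : ∑ t ∈ Ico 2 n, 4 / (t : ℝ) ^ 3 ≤ 1 := by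
  rcases lt_or_ge n 2 with hn | hn
  · simp [Ico_eq_empty_of_le hn.le]
  have htelescope : ∑ t ∈ Ico 2 n, 4 / (t : ℝ) ^ 3 ≤ 1 - 2 / (((n : ℝ) - 1) * n) := by
    induction n, hn using Nat.le_induction with
    | base => norm_num
    | succ n hn ih =>
      have hn' : (2 : ℝ) ≤ n := by exact_mod_cast hn
      have hpos : (0 : ℝ) < n - 1 := by linarith
      have hterm : 4 / (n : ℝ) ^ 3 ≤ 2 / ((n - 1) * n) - 2 / (n * (n + 1)) :=
        calc 4 / (n : ℝ) ^ 3 ≤ 4 / ((n - 1) * n * (n + 1)) := by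
              gcongr
              linarith
          _ = 2 / ((n - 1) * n) - 2 / (n * (n + 1)) := by
              field_simp
              ring
      rw [sum_Ico_succ_top hn]
      push_cast
      rw [add_sub_cancel_right]
      linarith
  have : 0 ≤ 2 / (((n : ℝ) - 1) * n) := by
    have : (2 : ℝ) ≤ n := by exact_mod_cast hn
    exact div_nonneg zero_le_two (mul_nonneg (by linarith) (by linarith))
  linarith

namespace IsUCBTeam

variable {V : Type*} [Fintype V] {G : SimpleGraph V} {K : ℕ} {Φ : (v : V) → UserPolicy G K v}
  {S : Finset V} {d : V} {ν : Fin K → Measure ℝ} {μ : Measure (RewardTable V K)}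
  [IsProbabilityMeasure μ] {i : Fin K} (h : IsUCBTeam Φ S d) (hΦ : ∀ v t, Measurable (Φ v t))
  (hμ : IsStochasticReward μ ν id)
include h hΦ hμ

theorem measureReal_deviation_le (hi : HasSubgaussianMGF (fun y => y - armMean ν i) 4⁻¹ (ν i))
    {t : ℕ} (ht : K ≤ t) {s : ℝ} (hs : s ^ 2 = 1) :
    μ.real {x | √(2 * pullCount Φ x t S i * Real.log t) ≤
      s * (rewardSum Φ x t S i - armMean ν i * pullCount Φ x t S i)} ≤ 2 / (t : ℝ) ^ 3 := by
  obtain ⟨𝒩, hcard, h𝒩, hcount⟩ := h.exists_finset_forall_pullCount_mem i ht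
  have ht1 : 1 ≤ t := i.pos.trans_le ht
  have ht0 : (t : ℝ) ≠ 0 := by exact_mod_cast Nat.one_le_iff_ne_zero.1 ht1
  calc _ ≤ #𝒩 / (t : ℝ) ^ 4 := measureReal_deviation_le_of_forall_mem hΦ hμ hi ht1 h𝒩 hcount hs
    _ ≤ (t * 2) / (t : ℝ) ^ 4 := by
        gcongr
        exact_mod_cast hcard
    _ = 2 / (t : ℝ) ^ 3 := by field_simp

variable (hν : ∀ i, HasSubgaussianMGF (fun y => y - armMean ν i) 4⁻¹ (ν i)) (hi : 0 < gap ν i)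
include hν hi

theorem measureReal_oversampling_le {n t : ℕ} (htn : t < n) :
    μ.real (oversampling Φ S d i (8 * Real.log n / gap ν i ^ 2) t) ≤ 4 / (t : ℝ) ^ 3 := by
  rcases lt_or_ge t K with ht | ht
  · rw [oversampling_eq_empty ht, measureReal_empty]
    positivity
  have : Nonempty (Fin K) := ⟨i⟩
  have ht0 : 0 < t := i.pos.trans_le ht
  obtain ⟨j, hj⟩ := exists_armMean_eq_bestMean ν
  have hpos (x : RewardTable V K) (k : Fin K) : (0 : ℝ) < pullCount Φ x t S k := by
    obtain ⟨𝒩, -, h𝒩, hcount⟩ := h.exists_finset_forall_pullCount_mem k ht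
    exact_mod_cast Nat.pos_of_ne_zero (ne_of_mem_of_not_mem (hcount x) h𝒩)
  let E (k : Fin K) (s : ℝ) := {x | √(2 * pullCount Φ x t S k * Real.log t) ≤
    s * (rewardSum Φ x t S k - armMean ν k * pullCount Φ x t S k)}
  have hsub : oversampling Φ S d i (8 * Real.log n / gap ν i ^ 2) t ⊆ E j (-1) ∪ E i 1 := by
    rintro x ⟨-, hact, hcount⟩
    refine deviation_of_index_le (hpos x j) (hpos x i) (hj ▸ sub_pos.1 hi) (le_trans ?_ hcount)
      (h.index_le_index x ht hact j)
    rw [hj, ← gap]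
    gcongr
  calc _ ≤ μ.real (E j (-1) ∪ E i 1) := measureReal_mono hsub (measure_ne_top _ _)
    _ ≤ μ.real (E j (-1)) + μ.real (E i 1) := measureReal_union_le _ _
    _ ≤ 2 / (t : ℝ) ^ 3 + 2 / (t : ℝ) ^ 3 := add_le_add
        (h.measureReal_deviation_le hΦ hμ (hν j) ht (by norm_num))
        (h.measureReal_deviation_le hΦ hμ (hν i) ht (by norm_num))
    _ = 4 / (t : ℝ) ^ 3 := by ring

theorem sum_measureReal_oversampling_le_one (n : ℕ) :
    ∑ t ∈ range n, μ.real (oversampling Φ S d i (8 * Real.log n / gap ν i ^ 2) t) ≤ 1 := by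
  have hstart (t : ℕ) (ht : t ∈ range n) (ht2 : t ∉ Ico 2 n) :
      μ.real (oversampling Φ S d i (8 * Real.log n / gap ν i ^ 2) t) = 0 := by
    have htK : t < K := by
      have := two_le_of_gap_pos hi
      simp only [mem_range, mem_Ico] at ht ht2
      omega
    rw [oversampling_eq_empty htK, measureReal_empty]
  rw [← sum_subset (fun t ht => mem_range.2 (mem_Ico.1 ht).2) hstart]
  exact (sum_le_sum fun t ht => h.measureReal_oversampling_le hΦ hμ hν hi (mem_Ico.1 ht).2).trans
    (sum_Ico_four_div_cube_le_one n)

theorem integral_pullCount_le (n : ℕ) : ∫ x, (pullCount Φ x n S i : ℝ) ∂μ ≤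
    8 * Real.log n / gap ν i ^ 2 + (3 * #S - 1) := by
  set L := 8 * Real.log n / gap ν i ^ 2
  have hL : 0 ≤ L := div_nonneg (mul_nonneg (by norm_num) (Real.log_natCast_nonneg n)) (sq_nonneg _)
  have hind (t : ℕ) :
      Integrable ((oversampling Φ S d i L t).indicator (1 : RewardTable V K → ℝ)) μ :=
    (integrable_const 1).indicator (measurableSet_oversampling hΦ i L t)
  have hsum := integrable_finsetSum (range n) fun t _ => hind t
  calc ∫ x, (pullCount Φ x n S i : ℝ) ∂μ
      ≤ ∫ x, (L + (2 * #S - 1) +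
          #S * ∑ t ∈ range n, (oversampling Φ S d i L t).indicator 1 x) ∂μ :=
        integral_mono (integrable_pullCount n S i hΦ μ)
          ((integrable_const _).add (hsum.const_mul _))
          fun x => h.pullCount_le_add_sum_indicator x i hL n
    _ = L + (2 * #S - 1) + #S * ∑ t ∈ range n, μ.real (oversampling Φ S d i L t) := by
        rw [integral_add (integrable_const _) (hsum.const_mul _), integral_const_mul,
          integral_finsetSum _ fun t _ => hind t]
        simp only [integral_const, probReal_univ, one_smul,
          integral_indicator_one (measurableSet_oversampling hΦ i L _)]
    _ ≤ L + (2 * #S - 1) + #S * 1 := by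
        gcongr
        exact h.sum_measureReal_oversampling_le_one hΦ hμ hν hi n
    _ = L + (3 * #S - 1) := by ring

end IsUCBTeam

end PullCountBound

section Regret

variable {V : Type*} {G : SimpleGraph V} {K : ℕ} {ν : Fin K → Measure ℝ}

theorem sum_regret_eq_sum_gap_mul_pullCount (ν : Fin K → Measure ℝ) (Φ : (v : V) → UserPolicy G K v)
    (x : RewardTable V K) (n : ℕ) (S : Finset V) :
    ∑ v ∈ S, ∑ t ∈ range n, (bestMean ν - armMean ν (action Φ x t v)) =
      ∑ i, gap ν i * pullCount Φ x n S i := by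
  have hround (t : ℕ) : ∑ v ∈ S, (bestMean ν - armMean ν (action Φ x t v)) =
      ∑ i, gap ν i * #(pullers Φ x t S i) := by
    rw [← sum_fiberwise S fun v => action Φ x t v]
    refine sum_congr rfl fun i _ => ?_
    rw [mul_comm, ← nsmul_eq_mul]
    exact sum_eq_card_nsmul fun v hv => by rw [(mem_filter.1 hv).2, gap]
  rw [sum_comm]
  simp only [hround, pullCount, Nat.cast_sum, mul_sum]
  exact sum_comm

theorem integrable_networkRegret [Fintype V] {Φ : (v : V) → UserPolicy G K v}
    (hΦ : ∀ v t, Measurable (Φ v t)) (μ : Measure (RewardTable V K)) [IsFiniteMeasure μ] (n : ℕ) :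
    Integrable (fun x => networkRegret ν Φ x n) μ := by
  simp only [networkRegret, sum_regret_eq_sum_gap_mul_pullCount]
  exact integrable_finsetSum _ fun i _ => (integrable_pullCount n univ i hΦ μ).const_mul _

theorem measurable_networkRegret [Fintype V] {Φ : (v : V) → UserPolicy G K v}
    (hΦ : ∀ v t, Measurable (Φ v t)) (n : ℕ) : Measurable fun x => networkRegret ν Φ x n := by
  simp only [networkRegret, sum_regret_eq_sum_gap_mul_pullCount]
  exact measurable_sum _ fun i _ =>
    (measurable_from_top.comp (measurable_pullCount n univ i hΦ)).const_mul _

theorem IsUCBTeam.integral_sum_gap_mul_pullCount_le [Fintype V] {Φ : (v : V) → UserPolicy G K v}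
    {S : Finset V} {d : V} {μ : Measure (RewardTable V K)} [IsProbabilityMeasure μ]
    (h : IsUCBTeam Φ S d) (hΦ : ∀ v t, Measurable (Φ v t)) (hμ : IsStochasticReward μ ν id)
    (hν : ∀ i, HasSubgaussianMGF (fun y => y - armMean ν i) 4⁻¹ (ν i)) (n : ℕ) :
    ∫ x, ∑ i, gap ν i * pullCount Φ x n S i ∂μ ≤
      ∑ i with armMean ν i < bestMean ν, 8 * Real.log n / gap ν i +
        (3 * #S - 1) * ∑ j, gap ν j := by
  rw [integral_finsetSum _ fun i _ => (integrable_pullCount n S i hΦ μ).const_mul _, sum_filter,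
    mul_sum, ← sum_add_distrib]
  refine sum_le_sum fun i _ => ?_
  rw [integral_const_mul]
  split_ifs with hlt
  · have hi : 0 < gap ν i := sub_pos.2 hlt
    calc gap ν i * ∫ x, (pullCount Φ x n S i : ℝ) ∂μ
        ≤ gap ν i * (8 * Real.log n / gap ν i ^ 2 + (3 * #S - 1)) := by
          gcongr
          exact h.integral_pullCount_le hΦ hμ hν hi n
      _ = 8 * Real.log n / gap ν i + (3 * #S - 1) * gap ν i := by field_simp
  · have hi : gap ν i = 0 := le_antisymm (sub_nonpos.2 (not_lt.1 hlt)) (gap_nonneg ν i)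
    simp only [hi, zero_mul, mul_zero, add_zero, le_refl]

end Regret

section FollowYourLeader

namespace DominatingPartition

variable {V : Type*} [Fintype V] [DecidableEq V] {G : SimpleGraph V} {D : Set V}
  (P : DominatingPartition G D)

/-- The component of `d` as a finite set: the users led by `d`, including `d` itself if `d ∈ D`. -/
def team (d : V) : Finset V :=
  {v | P.leader v = d}

theorem coe_team (d : V) : (P.team d : Set V) = P.component d :=
  coe_filter_univ _

variable [Fintype D]

theorem sum_sum_team {M : Type*} [AddCommMonoid M] (g : V → M) :
    ∑ d ∈ D.toFinset, ∑ v ∈ P.team d, g v = ∑ v, g v :=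
  sum_fiberwise_of_maps_to (fun v _ => Set.mem_toFinset.2 (P.leader_mem v)) g

end DominatingPartition

variable {V : Type*} {G : SimpleGraph V} {D : Set V} {K : ℕ} (P : DominatingPartition G D)
  {ψ : (v : V) → UserPolicy G K v} (a : V → Fin K)

theorem fylPolicy_of_mem {v : V} (hv : v ∈ D) : fylPolicy P ψ a v = ψ v :=
  dif_pos hv

theorem fylPolicy_of_notMem {v : V} (hv : v ∉ D) :
    fylPolicy P ψ a v = followerPolicy P hv (a v) :=
  dif_neg hv

theorem action_succ_of_notMem {v : V} (hv : v ∉ D) (x : RewardTable V K) (t : ℕ) :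
    action (fylPolicy P ψ a) x (t + 1) v = action (fylPolicy P ψ a) x t (P.leader v) := by
  rw [action_eq, fylPolicy_of_notMem P a hv]
  rfl

variable [Fintype V]

theorem measurable_fylPolicy (hψ : ∀ v ∈ D, IsUCBUser (P.component v) (ψ v)) (v : V) (t : ℕ) :
    Measurable (fylPolicy P ψ a v t) := by
  by_cases hv : v ∈ D
  · rw [fylPolicy_of_mem P a hv]
    exact (hψ v hv).measurable t
  · rw [fylPolicy_of_notMem P a hv]
    cases t with
    | zero => exact measurable_const
    | succ t =>
      unfold followerPolicy
      fun_prop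

theorem isUCBTeam_fylPolicy [DecidableEq V] (hψ : ∀ v ∈ D, IsUCBUser (P.component v) (ψ v)) {d : V}
    (hd : d ∈ D) : IsUCBTeam (fylPolicy P ψ a) (P.team d) d := by
  have hfollower {v : V} (hv : v ∈ P.team d) (hvd : v ≠ d) : P.leader v = d ∧ v ∉ D :=
    have hleader : P.leader v = d := (mem_filter.1 hv).2
    ⟨hleader, fun hvD => hvd ((P.leader_of_mem v hvD).symm.trans hleader)⟩
  exact
    { leader_mem := mem_filter.2 ⟨mem_univ d, P.leader_of_mem d hd⟩
      action_succ := fun v hv hvd x t => by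
        obtain ⟨hleader, hvD⟩ := hfollower hv hvd
        rw [action_succ_of_notMem P a hvD, hleader]
      mem_closedNbhd := fun v hv => or_iff_not_imp_left.2 fun hvd => by
        obtain ⟨hleader, hvD⟩ := hfollower hv hvd
        exact hleader ▸ (P.adj_leader v hvD).symm
      isUCBUser := by
        rw [P.coe_team, fylPolicy_of_mem P a hd]
        exact hψ d hd }

theorem integral_networkRegret_fylPolicy_le {ν : Fin K → Measure ℝ}
    {μ : Measure (RewardTable V K)} [IsProbabilityMeasure μ]
    (hψ : ∀ v ∈ D, IsUCBUser (P.component v) (ψ v)) (hμ : IsStochasticReward μ ν id)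
    (hν : ∀ i, HasSubgaussianMGF (fun y => y - armMean ν i) 4⁻¹ (ν i)) (n : ℕ) :
    ∫ x, networkRegret ν (fylPolicy P ψ a) x n ∂μ ≤
      D.ncard * ∑ i with armMean ν i < bestMean ν, 8 * Real.log n / gap ν i +
        (3 * Fintype.card V - D.ncard) * ∑ j, gap ν j := by
  classical
  have hΦ := measurable_fylPolicy P a hψ
  have hcard : ∑ d ∈ D.toFinset, (#(P.team d) : ℝ) = Fintype.card V := by
    simpa using P.sum_sum_team fun _ => (1 : ℝ)
  simp only [networkRegret, ← P.sum_sum_team, sum_regret_eq_sum_gap_mul_pullCount]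
  rw [integral_finsetSum _ fun d _ => integrable_finsetSum _ fun i _ =>
    (integrable_pullCount n (P.team d) i hΦ μ).const_mul _]
  refine (sum_le_sum fun d hd => (isUCBTeam_fylPolicy P a hψ
    (Set.mem_toFinset.1 hd)).integral_sum_gap_mul_pullCount_le hΦ hμ hν n).trans_eq ?_
  rw [sum_add_distrib, sum_const, nsmul_eq_mul, ← sum_mul, sum_sub_distrib, ← mul_sum, hcard,
    sum_const, nsmul_one, Set.ncard_eq_toFinset_card']

end FollowYourLeader

theorem hasSubgaussianMGF_sub_armMean {K : ℕ} {ν : Fin K → Measure ℝ} {i : Fin K}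
    [IsProbabilityMeasure (ν i)] (hi : ∀ᵐ y ∂(ν i), y ∈ Set.Icc (0 : ℝ) 1) :
    HasSubgaussianMGF (fun y => y - armMean ν i) 4⁻¹ (ν i) := by
  have hproxy : (‖(1 : ℝ) - 0‖₊ / 2) ^ 2 = 4⁻¹ := by
    rw [sub_zero, nnnorm_one]
    norm_num
  exact hproxy ▸ hasSubgaussianMGF_of_mem_Icc aemeasurable_id hi

-- A peeling argument for the random number of samples costs the factor on the right.
theorem one_half_le_peeling_constant {β : ℝ} (hβ : β ∈ Set.Ioo (1 / 4 : ℝ) 1) :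
    1 / 2 ≤ 1 / (4 * β - 1) * (1 + 1 / ((4 * β - 1) * Real.log (1 / β))) := by
  obtain ⟨hβ4, hβ1⟩ := hβ
  have hβ0 : 0 < β := by linarith
  have hpos : 0 < 4 * β - 1 := by linarith
  have hlog0 : 0 < Real.log (1 / β) := Real.log_pos ((one_lt_div hβ0).2 hβ1)
  have hprod : (4 * β - 1) * Real.log (1 / β) ≤ 2 :=
    calc (4 * β - 1) * Real.log (1 / β) ≤ (4 * β - 1) * (1 / β - 1) := by
          gcongr
          exact Real.log_le_sub_one_of_pos (by positivity)
      _ = (4 * β - 1) * (1 - β) / β := by field_simp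
      _ ≤ 2 := by
          rw [div_le_iff₀ hβ0]
          nlinarith [sq_nonneg (8 * β - 3)]
  calc (1 / 2 : ℝ) = 1 / 3 * (1 + 1 / 2) := by norm_num
    _ ≤ 1 / (4 * β - 1) * (1 + 1 / ((4 * β - 1) * Real.log (1 / β))) := by
        gcongr
        linarith

theorem three_mul_sub_one_le {β m : ℝ} (hβ : β ∈ Set.Ioo (1 / 4 : ℝ) 1) (hm : 0 ≤ m) :
    3 * m - 1 ≤ 2 * m - 1 + 2 * m / (4 * β - 1) *
      (1 + 1 / ((4 * β - 1) * Real.log (1 / β))) :=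
  calc 3 * m - 1 = 2 * m - 1 + 2 * m * (1 / 2) := by ring
    _ ≤ 2 * m - 1 + 2 * m * (1 / (4 * β - 1) *
        (1 + 1 / ((4 * β - 1) * Real.log (1 / β)))) := by
        gcongr
        exact one_half_le_peeling_constant hβ
    _ = _ := by ring

theorem theorem5_general {V : Type*} [Fintype V] {G : SimpleGraph V} {D : Set V} {K : ℕ}
    (P : DominatingPartition G D) (ψ : (v : V) → UserPolicy G K v)
    (hψ : ∀ v ∈ D, IsUCBUser (P.component v) (ψ v))
    {Ω : Type*} [MeasurableSpace Ω] (μ : Measure Ω) [IsProbabilityMeasure μ]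
    (ν : Fin K → Measure ℝ)
    (hν : ∀ i, HasSubgaussianMGF (fun y => y - armMean ν i) 4⁻¹ (ν i))
    (X : Ω → RewardTable V K) (hX : IsStochasticReward μ ν X)
    (A : Ω → V → Fin K) (hA : AEMeasurable A μ) (hAX : IndepFun A X μ) (n : ℕ) :
    Integrable (fun ω => networkRegret ν (fylPolicy P ψ (A ω)) (X ω) n) μ ∧
    ∫ ω, networkRegret ν (fylPolicy P ψ (A ω)) (X ω) n ∂μ ≤
      D.ncard * ∑ i with armMean ν i < bestMean ν, 8 * Real.log n / gap ν i +
        (3 * Fintype.card V - D.ncard) * ∑ j, gap ν j := by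
  have := Measure.isProbabilityMeasure_map hX.aemeasurable
  have hΦ (a : V → Fin K) := measurable_fylPolicy P a hψ
  exact integral_le_of_indepFun_of_forall_le hA hX.aemeasurable hAX
    (F := fun a x => networkRegret ν (fylPolicy P ψ a) x n)
    (fun a => measurable_networkRegret (hΦ a) n)
    (fun a => integrable_networkRegret (hΦ a) _ n)
    (fun a => integral_networkRegret_fylPolicy_le P a hψ hX.map hν n)

theorem theorem5 {V : Type*} [Fintype V] (c : V) {K : ℕ} [NeZero K]
    (P : DominatingPartition (SimpleGraph.starGraph c) {c})
    (ψ : (v : V) → UserPolicy (SimpleGraph.starGraph c) K v)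
    (hψ : ∀ v ∈ ({c} : Set V), IsUCBUser (P.component v) (ψ v))
    {Ω : Type*} [MeasurableSpace Ω] (μ : Measure Ω) [IsProbabilityMeasure μ]
    (ν : Fin K → Measure ℝ) (hν : ∀ i, ∀ᵐ y ∂(ν i), y ∈ Set.Icc (0 : ℝ) 1)
    (X : Ω → RewardTable V K) (hX : IsStochasticReward μ ν X)
    (A : Ω → V → Fin K) (hA : Measurable A) (hAX : IndepFun A X μ)
    (n : ℕ) (β : ℝ) (hβ : β ∈ Set.Ioo (1 / 4 : ℝ) 1) :
    Integrable (fun ω => networkRegret ν (fylPolicy P ψ (A ω)) (X ω) n) μ ∧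
    ∫ ω, networkRegret ν (fylPolicy P ψ (A ω)) (X ω) n ∂μ ≤
      (∑ i with armMean ν i < bestMean ν, 8 * Real.log n / gap ν i) +
        (2 * (Fintype.card V : ℝ) - 1 + 2 * (Fintype.card V : ℝ) / (4 * β - 1) *
          (1 + 1 / ((4 * β - 1) * Real.log (1 / β)))) * ∑ j, gap ν j := by
  have (i : Fin K) : IsProbabilityMeasure (ν i) := (hX.law c i 0).isProbabilityMeasure_iff.1 ‹_›
  refine (theorem5_general P ψ hψ μ ν (fun i => hasSubgaussianMGF_sub_armMean (hν i)) X hX A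
    hA.aemeasurable hAX n).imp_right fun hle => hle.trans ?_
  rw [Set.ncard_singleton, Nat.cast_one, one_mul]
  gcongr
  · exact sum_nonneg fun j _ => gap_nonneg ν j
  · exact three_mul_sub_one_le hβ (Nat.cast_nonneg _)
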